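/- Let $d \ge 2$ and $m \ge 1$ be integers and let $0 \le f \le 1$. For an integer $k\ge 1$ let $\Psi_k = |\Psi_k\rangle\langle\Psi_k|$ with $|\Psi_k\rangle = \frac{1}{\sqrt k}\sum_{i=1}^k |ii\rangle \in \mathbb{C}^k\otimes\mathbb{C}^k$, and let $$\rho_f = f\,\Psi_d + \frac{1-f}{d^2-1}\,(\mathbb{1}-\Psi_d)$$ be the isotropic state on $AB$, where $A=B=\mathbb{C}^d$. Write $X^{T_B}$ for the partial transpose on the second party and $\|\cdot\|_1$ for the trace norm. For a bipartite system, let $\mathsf{SEP}$ be the convex hull of the projectors onto unit product vectors, let $\mathsf{PPT}_+ = \{X \succeq 0 : \operatorname{Tr}X=1,\ X^{T_B}\succeq 0\}$, and let $\mathsf{R}=\{X\succeq 0 : \|X^{T_B}\|_1\le 1\}$ be the Rains set. Consider completely positive trace-preserving linear maps $\Lambda$ from operators on $AB$ to operators on $A'B'$, where $A'=B'=\mathbb{C}^m$, and let $J_\Lambda=\sum_{x,y}|x\rangle\langle y|\otimes\Lambda(|x\rangle\langle y|)$ be the (unnormalised) Choi matrix, $x,y$ ranging over the product basis of $AB$.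 Such a map $\Lambda$ belongs to * $\mathrm{SEP}$ if $J_\Lambda$ is separable across $AA'|BB'$, i.e. a nonnegative multiple of a separable state; * $\mathrm{PPT}$ if $J_\Lambda^{T_{BB'}}\succeq 0$; * the Rains-preserving operations if $X\in\mathsf{R}\Rightarrow\Lambda(X)\in\mathsf{R}$; * the $\mathsf{PPT}_+$-preserving operations if $\sigma\in\mathsf{PPT}_+\Rightarrow\Lambda(\sigma)\in\mathsf{PPT}_+$; * the separability-preserving operations $\mathrm{SEPP}$ if $\sigma\in\mathsf{SEP}\Rightarrow\Lambda(\sigma)\in\mathsf{SEP}$. For each of these five classes $\mathcal{O}$ let $F_{\mathcal O}(\rho_f,m)=\sup_{\Lambda\in\mathcal O}\operatorname{Tr}\big(\Lambda(\rho_f)\Psi_m\big)$ be the fidelity of distillation. Then, for each of the five classes $\mathcal O$: * if $f\le \frac1d$, then $F_{\mathcal O}(\rho_f,m)=\frac1m$; * if $f\ge\frac1d$ and $m\le d$, then $$F_{\mathcal O}(\rho_f,m)=\frac{df-1}{d-1}+\frac{d(1-f)}{m(d-1)}.$$ In particular, all five classes achieve the same fidelity of distillation in these cases. -/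

import Mathlib

namespace EntDist

open scoped ComplexOrder

/-- Operators on the bipartite space `ℂ^A ⊗ ℂ^B`, as matrices in the product basis. -/
abbrev BipOp (A B : Type) : Type := Matrix (A × B) (A × B) ℂ

/-- Linear maps from operators on `AB` to operators on `A'B'`. -/
abbrev BipMap (A B A' B' : Type) : Type := BipOp A B →ₗ[ℂ] BipOp A' B'

/-- Partial transpose on the second tensor factor. -/
def partialTranspose {A B : Type} (X : BipOp A B) : BipOp A B :=
  Matrix.of fun p q => X (p.1, q.2) (q.1, p.2)

/-- The trace norm: the sum of the singular values. -/
noncomputable def traceNorm {n : Type} [Fintype n] [DecidableEq n] (M : Matrix n n ℂ) : ℝ :=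
  ∑ i, Real.sqrt ((Matrix.isHermitian_conjTranspose_mul_self M).eigenvalues i)

section States

variable (A B : Type) [Fintype A] [Fintype B]

/-- The rank-one operators `|ψ⟩⟨ψ|` with `|ψ⟩ = |φ⟩ ⊗ |η⟩` for unit vectors `φ`, `η`. -/
def productProjectors : Set (BipOp A B) :=
  {X | ∃ (φ : A → ℂ) (η : B → ℂ), star φ ⬝ᵥ φ = 1 ∧ star η ⬝ᵥ η = 1 ∧
    X = Matrix.vecMulVec (fun p : A × B => φ p.1 * η p.2)
      (star fun p : A × B => φ p.1 * η p.2)}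

/-- The separable states. -/
def sepStates : Set (BipOp A B) := convexHull ℝ (productProjectors A B)

/-- The states with positive partial transpose. -/
def pptPlusStates : Set (BipOp A B) :=
  {X | X.trace = 1 ∧ X.PosSemidef ∧ (partialTranspose X).PosSemidef}

/-- The Rains set: positive semidefinite operators whose partial transpose has trace norm at
most one. -/
def rainsSet [DecidableEq A] [DecidableEq B] : Set (BipOp A B) :=
  {X | X.PosSemidef ∧ traceNorm (partialTranspose X) ≤ 1}

end States

/-- The action of `id_k ⊗ Λ`. -/
def ampliation {n n' : Type} (k : ℕ) (Λ : Matrix n n ℂ →ₗ[ℂ] Matrix n' n' ℂ)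
    (M : Matrix (Fin k × n) (Fin k × n) ℂ) : Matrix (Fin k × n') (Fin k × n') ℂ :=
  Matrix.of fun p q => Λ (Matrix.of fun a b => M (p.1, a) (q.1, b)) p.2 q.2

/-- Completely positive and trace-preserving linear maps. -/
structure IsCPTP {n n' : Type} [Fintype n] [Fintype n']
    (Λ : Matrix n n ℂ →ₗ[ℂ] Matrix n' n' ℂ) : Prop where
  completelyPositive : ∀ (k : ℕ) (M : Matrix (Fin k × n) (Fin k × n) ℂ),
    M.PosSemidef → (ampliation k Λ M).PosSemidef
  tracePreserving : ∀ M : Matrix n n ℂ, (Λ M).trace = M.trace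

/-- The (unnormalised) Choi matrix `J_Λ = ∑ |ab⟩⟨ce| ⊗ Λ(|ab⟩⟨ce|)`, with the tensor factors
grouped according to the bipartition `AA' | BB'`. -/
def choi {A B A' B' : Type} [DecidableEq A] [DecidableEq B] (Λ : BipMap A B A' B') :
    BipOp (A × A') (B × B') :=
  Matrix.of fun p q =>
    Λ (Matrix.single (p.1.1, p.2.1) (q.1.1, q.2.1) 1) (p.1.2, p.2.2) (q.1.2, q.2.2)

section Operations

variable (A B A' B' : Type) [Fintype A] [Fintype B] [Fintype A'] [Fintype B']

/-- Separable operations: channels whose Choi matrix is separable across `AA' | BB'`, that is, a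
nonnegative multiple of a separable state. -/
def sepOps [DecidableEq A] [DecidableEq B] : Set (BipMap A B A' B') :=
  {Λ | IsCPTP Λ ∧ ∃ t : ℝ, 0 ≤ t ∧ ∃ σ ∈ sepStates (A × A') (B × B'), choi Λ = t • σ}

/-- PPT operations: channels whose Choi matrix has a positive semidefinite partial transpose
across `AA' | BB'`. -/
def pptOps [DecidableEq A] [DecidableEq B] : Set (BipMap A B A' B') :=
  {Λ | IsCPTP Λ ∧ (partialTranspose (choi Λ)).PosSemidef}

/-- Rains-preserving operations: channels mapping the Rains set into the Rains set. -/
def rainsPreservingOps [DecidableEq A] [DecidableEq B] [DecidableEq A'] [DecidableEq B'] :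
    Set (BipMap A B A' B') :=
  {Λ | IsCPTP Λ ∧ ∀ X ∈ rainsSet A B, Λ X ∈ rainsSet A' B'}

/-- Channels mapping states with positive partial transpose to such states. -/
def pptPlusPreservingOps : Set (BipMap A B A' B') :=
  {Λ | IsCPTP Λ ∧ ∀ σ ∈ pptPlusStates A B, Λ σ ∈ pptPlusStates A' B'}

/-- Separability-preserving operations: channels mapping separable states to separable states. -/
def sepPreservingOps : Set (BipMap A B A' B') :=
  {Λ | IsCPTP Λ ∧ ∀ σ ∈ sepStates A B, Λ σ ∈ sepStates A' B'}

end Operations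

/-- The vector `∑ i, |ii⟩ / √m`. -/
noncomputable def maxEntVec (m : ℕ) : Fin m × Fin m → ℂ :=
  fun p => if p.1 = p.2 then ((1 / Real.sqrt m : ℝ) : ℂ) else 0

/-- The maximally entangled state `Ψ_m` of local dimension `m`. -/
noncomputable def maxEnt (m : ℕ) : BipOp (Fin m) (Fin m) :=
  Matrix.vecMulVec (maxEntVec m) (star (maxEntVec m))

/-- The fidelity of distillation: the supremum of `⟨Λ(ρ), Ψ_m⟩` over `Λ` in the class `O`, with
the Hilbert–Schmidt inner product. -/
noncomputable def fidelityOfDistillation {A B : Type} {m : ℕ}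
    (O : Set (BipMap A B (Fin m) (Fin m))) (ρ : BipOp A B) : ℝ :=
  sSup ((fun Λ : BipMap A B (Fin m) (Fin m) => (((Λ ρ).conjTranspose * maxEnt m).trace).re) '' O)

/-- The isotropic state `f Ψ_d + (1 - f) / (d² - 1) (𝟙 - Ψ_d)`. -/
noncomputable def isotropic (d : ℕ) (f : ℝ) : BipOp (Fin d) (Fin d) :=
  f • maxEnt d + ((1 - f) / ((d : ℝ) ^ 2 - 1)) • (1 - maxEnt d)

end EntDist

namespace EntDist

open scoped ComplexOrder
open Matrix

/-! ### Trace norm of Hermitian matrices and its duality with operators between `-1` and `1`. -/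

section TraceNorm

variable {n : Type} [Fintype n]

/-! All five classes contain the separable channels and send separable states into the Rains set,
and only these two facts are used (`fidelityOfDistillation_isotropic`).

Upper bound. The partial transpose of `Ψ_m` is the swap operator divided by `m`, and the swap has
spectrum in `{1, -1}`. By duality with the trace norm, every element of the Rains set has overlap at
most `1/m` with `Ψ_m` (`fidelity_le_of_mem_rainsSet`). For `f ≤ 1/d` the isotropic state is
separable (`isotropic_mem_sepStates`), so its image has overlap at most `1/m`. For `f ≥ 1/d` it is a
convex combination of `Ψ_d`, whose image has overlap at most `1`, and of `ρ_{1/d}`, whose image has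
overlap at most `1/m`; the overlap is linear, which gives the stated bound.

Attainment. Preparing `|00⟩` always gives `1/m`. For `m ≤ d`, take the `d` cyclic windows of `m`
consecutive indices. One party measures a random window with the POVM `P_k / m`, the other tests for
the same window; if the test succeeds both keep their states, otherwise they prepare `|00⟩`. The
test never fails on `Ψ_d`, which becomes `Ψ_m`, and the value on the identity is a count
(`exists_sepOps_distillation`). These two values determine the fidelity on every isotropic state. -/

open scoped MatrixOrder in
theorem exists_eq_conjTranspose_mul_self [DecidableEq n] {P : Matrix n n ℂ} (hP : P.PosSemidef) :
    ∃ D : Matrix n n ℂ, P = Dᴴ * D :=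
  CStarAlgebra.nonneg_iff_eq_star_mul_self.mp hP.nonneg

/-- The trace of a product of two positive semidefinite matrices is nonnegative. -/
theorem re_trace_mul_nonneg {P S : Matrix n n ℂ} (hP : P.PosSemidef) (hS : S.PosSemidef) :
    0 ≤ (P * S).trace.re := by
  classical
  obtain ⟨D, rfl⟩ := exists_eq_conjTranspose_mul_self hP
  rw [Matrix.mul_assoc, Matrix.trace_mul_comm]
  exact (Complex.le_def.1 (hS.mul_mul_conjTranspose_same D).trace_nonneg).1

/-- If `-1 ≤ S ≤ 1` then `tr ((P - Q) S) ≤ tr P + tr Q` for positive semidefinite `P`, `Q`. -/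
theorem re_trace_sub_mul_le [DecidableEq n] {P Q S : Matrix n n ℂ} (hP : P.PosSemidef)
    (hQ : Q.PosSemidef) (hS₁ : (1 - S).PosSemidef) (hS₂ : (1 + S).PosSemidef) :
    ((P - Q) * S).trace.re ≤ P.trace.re + Q.trace.re := by
  have h₁ := re_trace_mul_nonneg hP hS₁
  have h₂ := re_trace_mul_nonneg hQ hS₂
  simp only [Matrix.mul_sub, Matrix.mul_add, Matrix.sub_mul, Matrix.mul_one, Matrix.trace_sub,
    Matrix.trace_add, Complex.sub_re, Complex.add_re] at *
  linarith

theorem trace_conj_diagonal [DecidableEq n] {U : Matrix n n ℂ} (hU : Uᴴ * U = 1) (D : n → ℂ) :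
    (U * diagonal D * Uᴴ).trace = ∑ i, D i := by
  rw [Matrix.trace_mul_cycle, hU, Matrix.one_mul, Matrix.trace_diagonal]

theorem conj_diagonal_mul_conj_diagonal [DecidableEq n] {U : Matrix n n ℂ} (hU : Uᴴ * U = 1)
    (D E : n → ℂ) :
    (U * diagonal D * Uᴴ) * (U * diagonal E * Uᴴ) = U * diagonal (fun i => D i * E i) * Uᴴ := by
  calc _ = U * diagonal D * (Uᴴ * U) * diagonal E * Uᴴ := by simp only [Matrix.mul_assoc]
    _ = _ := by rw [hU, Matrix.mul_one, Matrix.mul_assoc U, Matrix.diagonal_mul_diagonal]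

/-- The trace norm of a unitarily diagonalised Hermitian matrix. -/
theorem traceNorm_conj_diagonal [DecidableEq n] {U : Matrix n n ℂ} (hU : Uᴴ * U = 1) (D : n → ℝ) :
    traceNorm (U * diagonal (fun i => (D i : ℂ)) * Uᴴ) = ∑ i, |D i| := by
  set M := U * diagonal (fun i => (D i : ℂ)) * Uᴴ with hM
  have hMM : Mᴴ * M = U * diagonal (fun i => ((D i ^ 2 : ℝ) : ℂ)) * Uᴴ := by
    have : Mᴴ = M := by
      rw [hM]
      simp only [conjTranspose_mul, conjTranspose_conjTranspose, diagonal_conjTranspose,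
        Matrix.mul_assoc]
      congr 3
      ext i
      simp
    rw [this, hM, conj_diagonal_mul_conj_diagonal hU]
    congr 3
    ext i
    push_cast
    ring
  -- Comparing the eigenvalues with the `D i ^ 2` as multisets of roots of the characteristic
  -- polynomial avoids matching their orderings.
  have hroots := (isHermitian_conjTranspose_mul_self M).roots_charpoly_eq_eigenvalues
  have hchar : (Mᴴ * M).charpoly.roots
      = Multiset.map (fun i => ((D i ^ 2 : ℝ) : ℂ)) Finset.univ.val := by
    rw [hMM, charpoly_mul_comm, ← Matrix.mul_assoc, hU, Matrix.one_mul, charpoly_diagonal,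
      Polynomial.roots_prod]
    · simp only [Polynomial.roots_X_sub_C, Multiset.bind_singleton]
    · exact Finset.prod_ne_zero_iff.2 fun i _ => Polynomial.X_sub_C_ne_zero _
  rw [hchar] at hroots
  have := congrArg (fun s => (Multiset.map (fun z : ℂ => Real.sqrt z.re) s).sum) hroots
  simp only [Multiset.map_map, Function.comp_apply] at this
  simp only [traceNorm]
  refine Eq.trans ?_ (this.symm.trans ?_)
  · rfl
  · change ∑ i, Real.sqrt (((D i ^ 2 : ℝ) : ℂ)).re = _
    simp only [Complex.ofReal_re, Real.sqrt_sq_eq_abs]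

theorem exists_eq_conj_diagonal [DecidableEq n] {H : Matrix n n ℂ} (hH : H.IsHermitian) :
    ∃ (U : Matrix n n ℂ) (D : n → ℝ), Uᴴ * U = 1 ∧ U * Uᴴ = 1 ∧
      H = U * diagonal (fun i => (D i : ℂ)) * Uᴴ :=
  ⟨hH.eigenvectorUnitary, hH.eigenvalues, Unitary.coe_star_mul_self _,
    Unitary.coe_mul_star_self _, hH.spectral_theorem⟩

theorem posSemidef_conj_diagonal [DecidableEq n] (U : Matrix n n ℂ) {D : n → ℝ}
    (hD : ∀ i, 0 ≤ D i) : (U * diagonal (fun i => (D i : ℂ)) * Uᴴ).PosSemidef :=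
  (PosSemidef.diagonal fun i => by simpa using hD i).mul_mul_conjTranspose_same U

/-- The Jordan decomposition attains the trace norm. -/
theorem exists_posSemidef_sub_eq [DecidableEq n] {H : Matrix n n ℂ} (hH : H.IsHermitian) :
    ∃ P Q : Matrix n n ℂ, P.PosSemidef ∧ Q.PosSemidef ∧ H = P - Q ∧
      P.trace.re + Q.trace.re = traceNorm H := by
  obtain ⟨U, D, hU, -, rfl⟩ := exists_eq_conj_diagonal hH
  refine ⟨U * diagonal (fun i => (((D i)⁺ : ℝ) : ℂ)) * Uᴴ,
    U * diagonal (fun i => (((D i)⁻ : ℝ) : ℂ)) * Uᴴ,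
    posSemidef_conj_diagonal U fun i => posPart_nonneg _,
    posSemidef_conj_diagonal U fun i => negPart_nonneg _, ?_, ?_⟩
  · rw [← Matrix.sub_mul, ← Matrix.mul_sub, diagonal_sub]
    congr 3
    ext i
    rw [← Complex.ofReal_sub, posPart_sub_negPart]
  · rw [trace_conj_diagonal hU, trace_conj_diagonal hU, traceNorm_conj_diagonal hU,
      ← Complex.ofReal_sum, ← Complex.ofReal_sum, Complex.ofReal_re, Complex.ofReal_re,
      ← Finset.sum_add_distrib]
    simp only [posPart_add_negPart]

/-- Any decomposition into positive semidefinite parts bounds the trace norm. -/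
theorem traceNorm_sub_le [DecidableEq n] {P Q : Matrix n n ℂ} (hP : P.PosSemidef)
    (hQ : Q.PosSemidef) : traceNorm (P - Q) ≤ P.trace.re + Q.trace.re := by
  obtain ⟨U, D, hU, hU', h⟩ := exists_eq_conj_diagonal (hP.isHermitian.sub hQ.isHermitian)
  -- The sign of `P - Q` is the test operator that attains the trace norm in the duality.
  let s : n → ℝ := fun i => SignType.sign (D i)
  have hs : ∀ i, -1 ≤ s i ∧ s i ≤ 1 ∧ D i * s i = |D i| := fun i => by
    refine ⟨?_, ?_, self_mul_sign (D i)⟩ <;> rcases lt_trichotomy (D i) 0 with h | h | h <;>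
      simp [s, h]
  have hone : (1 : Matrix n n ℂ) = U * diagonal (fun _ => ((1 : ℝ) : ℂ)) * Uᴴ := by
    simp [hU']
  have key := re_trace_sub_mul_le hP hQ (S := U * diagonal (fun i => (s i : ℂ)) * Uᴴ) ?_ ?_
  · rw [h, conj_diagonal_mul_conj_diagonal hU, trace_conj_diagonal hU] at key
    rw [h, traceNorm_conj_diagonal hU]
    simp only [← Complex.ofReal_mul, (hs _).2.2, ← Complex.ofReal_sum, Complex.ofReal_re] at key
    exact key
  · rw [hone, ← Matrix.sub_mul, ← Matrix.mul_sub, diagonal_sub]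
    simp only [← Complex.ofReal_sub]
    exact posSemidef_conj_diagonal U fun i => by linarith [(hs i).2.1]
  · rw [hone, ← Matrix.add_mul, ← Matrix.mul_add, diagonal_add]
    simp only [← Complex.ofReal_add]
    exact posSemidef_conj_diagonal U fun i => by linarith [(hs i).1]

end TraceNorm

/-! ### The separable cone, partial transposition, and the chain of inclusions `SEP ⊆ PPT₊ ⊆ R`. -/

section Separable

variable {A B : Type}

/-- The tensor product of two vectors. -/
def prodVec (φ : A → ℂ) (η : B → ℂ) : A × B → ℂ := fun p => φ p.1 * η p.2

/-- The rank-one operator `|φ ⊗ η⟩⟨φ ⊗ η|`, without normalisation. -/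
def prodProj (φ : A → ℂ) (η : B → ℂ) : BipOp A B :=
  vecMulVec (prodVec φ η) (star (prodVec φ η))

theorem prodProj_apply (φ : A → ℂ) (η : B → ℂ) (p q : A × B) :
    prodProj φ η p q = φ p.1 * η p.2 * (star (φ q.1) * star (η q.2)) := by
  simp [prodProj, prodVec, vecMulVec_apply]

variable (A B) in
/-- The cone of unnormalised separable operators. -/
def sepCone : AddSubmonoid (BipOp A B) :=
  AddSubmonoid.closure {X | ∃ (φ : A → ℂ) (η : B → ℂ), X = prodProj φ η}

theorem prodProj_mem_sepCone (φ : A → ℂ) (η : B → ℂ) : prodProj φ η ∈ sepCone A B :=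
  AddSubmonoid.subset_closure ⟨φ, η, rfl⟩

theorem sepCone_induction {motive : (X : BipOp A B) → X ∈ sepCone A B → Prop}
    (prod : ∀ φ η, motive (prodProj φ η) (prodProj_mem_sepCone φ η)) (zero : motive 0 (zero_mem _))
    (add : ∀ X Y hX hY, motive X hX → motive Y hY → motive (X + Y) (add_mem hX hY))
    {X : BipOp A B} (hX : X ∈ sepCone A B) : motive X hX := by
  induction hX using AddSubmonoid.closure_induction with
  | mem x hx => obtain ⟨φ, η, rfl⟩ := hx; exact prod φ η
  | zero => exact zero
  | add x y hx hy ihx ihy => exact add x y hx hy ihx ihy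

theorem smul_prodProj (φ : A → ℂ) (η : B → ℂ) {t : ℝ} (ht : 0 ≤ t) :
    t • prodProj φ η = prodProj ((Real.sqrt t : ℂ) • φ) η := by
  ext p q
  have : ((Real.sqrt t : ℂ)) * (Real.sqrt t : ℂ) = t := by
    rw [← Complex.ofReal_mul, Real.mul_self_sqrt ht]
  simp only [Matrix.smul_apply, prodProj_apply, Pi.smul_apply, smul_eq_mul, Complex.real_smul,
    star_mul', Complex.star_def, Complex.conj_ofReal, ← this]
  ring

theorem smul_mem_sepCone {X : BipOp A B} (hX : X ∈ sepCone A B) {t : ℝ} (ht : 0 ≤ t) :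
    t • X ∈ sepCone A B := by
  induction hX using sepCone_induction with
  | prod φ η => rw [smul_prodProj φ η ht]; exact prodProj_mem_sepCone _ _
  | zero => rw [smul_zero]; exact zero_mem _
  | add X Y _ _ hX hY => rw [smul_add]; exact add_mem hX hY

@[simp]
theorem partialTranspose_apply (X : BipOp A B) (p q : A × B) :
    partialTranspose X p q = X (p.1, q.2) (q.1, p.2) := rfl

@[simp]
theorem partialTranspose_sub (X Y : BipOp A B) :
    partialTranspose (X - Y) = partialTranspose X - partialTranspose Y := rfl

@[simp]
theorem partialTranspose_partialTranspose (X : BipOp A B) :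
    partialTranspose (partialTranspose X) = X := rfl

theorem isHermitian_partialTranspose {X : BipOp A B} (hX : X.IsHermitian) :
    (partialTranspose X).IsHermitian := by
  ext p q
  simpa using hX.apply (p.1, q.2) (q.1, p.2)

/-- Transposing `|η⟩⟨η|` conjugates `η`. This is why separable operators have positive partial
transpose. -/
theorem partialTranspose_prodProj (φ : A → ℂ) (η : B → ℂ) :
    partialTranspose (prodProj φ η) = prodProj φ (star η) := by
  ext p q
  simp only [partialTranspose_apply, prodProj_apply, Pi.star_apply, star_star]
  ring

theorem partialTranspose_mem_sepCone {X : BipOp A B} (hX : X ∈ sepCone A B) :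
    partialTranspose X ∈ sepCone A B := by
  induction hX using sepCone_induction with
  | prod φ η => rw [partialTranspose_prodProj]; exact prodProj_mem_sepCone _ _
  | zero => exact zero_mem _
  | add X Y _ _ hX hY => exact add_mem hX hY

variable [Fintype A] [Fintype B]

@[simp]
theorem trace_partialTranspose (X : BipOp A B) : (partialTranspose X).trace = X.trace := rfl

theorem posSemidef_prodProj (φ : A → ℂ) (η : B → ℂ) : (prodProj φ η).PosSemidef :=
  posSemidef_vecMulVec_self_star _

theorem posSemidef_of_mem_sepCone {X : BipOp A B} (hX : X ∈ sepCone A B) : X.PosSemidef := by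
  induction hX using sepCone_induction with
  | prod φ η => exact posSemidef_prodProj φ η
  | zero => exact PosSemidef.zero
  | add X Y _ _ hX hY => exact hX.add hY

theorem sum_star_mul_self (φ : A → ℂ) : star φ ⬝ᵥ φ = ((∑ a, ‖φ a‖ ^ 2 : ℝ) : ℂ) := by
  simp [dotProduct, Complex.conj_mul']

theorem exists_eq_smul_unit [Nonempty A] (φ : A → ℂ) :
    ∃ (r : ℝ) (φ' : A → ℂ), star φ' ⬝ᵥ φ' = 1 ∧ φ = (r : ℂ) • φ' := by
  classical
  by_cases h : (∑ a, ‖φ a‖ ^ 2 : ℝ) = 0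
  · refine ⟨0, Pi.single (Classical.arbitrary A) 1, by simp [dotProduct, Pi.single_apply], ?_⟩
    ext a
    rw [Finset.sum_eq_zero_iff_of_nonneg (fun _ _ => by positivity)] at h
    simpa using h a (Finset.mem_univ a)
  · set s := (∑ a, ‖φ a‖ ^ 2 : ℝ) with hs
    have hs0 : 0 ≤ s := Finset.sum_nonneg fun _ _ => by positivity
    have hr : Real.sqrt s ≠ 0 := by rwa [Real.sqrt_ne_zero hs0]
    refine ⟨Real.sqrt s, ((Real.sqrt s)⁻¹ : ℝ) • φ, ?_, ?_⟩
    · rw [sum_star_mul_self, ← Complex.ofReal_one]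
      congr 1
      simp only [Pi.smul_apply, norm_smul, mul_pow, ← Finset.mul_sum, ← hs, Real.norm_eq_abs,
        sq_abs, inv_pow, Real.sq_sqrt hs0]
      exact inv_mul_cancel₀ h
    · ext a
      have hr' : (Real.sqrt s : ℂ) ≠ 0 := by exact_mod_cast hr
      simp [hr']

theorem trace_prodProj (φ : A → ℂ) (η : B → ℂ) :
    (prodProj φ η).trace = (star φ ⬝ᵥ φ) * (star η ⬝ᵥ η) := by
  simp only [Matrix.trace, Matrix.diag, prodProj_apply, dotProduct, Fintype.sum_prod_type,
    Finset.sum_mul_sum, Pi.star_apply]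
  refine Finset.sum_congr rfl fun a _ => Finset.sum_congr rfl fun b _ => ?_
  ring

theorem convex_sepCone_trace_one :
    Convex ℝ {X : BipOp A B | X ∈ sepCone A B ∧ X.trace = 1} := by
  intro X hX Y hY a b ha hb hab
  refine ⟨add_mem (smul_mem_sepCone hX.1 ha) (smul_mem_sepCone hY.1 hb), ?_⟩
  rw [Matrix.trace_add, Matrix.trace_smul, Matrix.trace_smul, hX.2, hY.2, ← add_smul, hab, one_smul]

theorem sepStates_subset {X : BipOp A B} (hX : X ∈ sepStates A B) :
    X ∈ sepCone A B ∧ X.trace = 1 := by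
  refine convexHull_min (fun Y hY => ?_) convex_sepCone_trace_one hX
  obtain ⟨φ, η, hφ, hη, rfl⟩ := hY
  refine ⟨prodProj_mem_sepCone φ η, ?_⟩
  exact (trace_prodProj φ η).trans (by rw [hφ, hη, one_mul])

/-- Passes from the cone, where closure properties are easy, back to the convex hull of normalised
projectors. Nonemptiness provides a state to pair with `t = 0`. -/
theorem exists_eq_smul_sepStates [Nonempty A] [Nonempty B] {X : BipOp A B}
    (hX : X ∈ sepCone A B) : ∃ t : ℝ, 0 ≤ t ∧ ∃ σ ∈ sepStates A B, X = t • σ := by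
  induction hX using sepCone_induction with
  | prod φ η =>
    obtain ⟨r, φ', hφ', rfl⟩ := exists_eq_smul_unit φ
    obtain ⟨s, η', hη', rfl⟩ := exists_eq_smul_unit η
    refine ⟨r ^ 2 * s ^ 2, by positivity, prodProj φ' η',
      subset_convexHull ℝ _ ⟨φ', η', hφ', hη', rfl⟩, ?_⟩
    ext p q
    simp only [prodProj_apply, Pi.smul_apply, smul_eq_mul, Matrix.smul_apply, Complex.real_smul,
      star_mul', Complex.star_def, Complex.conj_ofReal, Complex.ofReal_mul, Complex.ofReal_pow]
    ring
  | zero =>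
    obtain ⟨-, φ, hφ, -⟩ := exists_eq_smul_unit (0 : A → ℂ)
    obtain ⟨-, η, hη, -⟩ := exists_eq_smul_unit (0 : B → ℂ)
    exact ⟨0, le_rfl, prodProj φ η, subset_convexHull ℝ _ ⟨φ, η, hφ, hη, rfl⟩, by simp⟩
  | add X Y _ _ hX hY =>
    obtain ⟨t, ht, σ, hσ, rfl⟩ := hX
    obtain ⟨s, hs, τ, hτ, rfl⟩ := hY
    rcases (add_nonneg ht hs).eq_or_lt with h | h
    · have ht0 : t = 0 := by linarith
      have hs0 : s = 0 := by linarith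
      exact ⟨0, le_rfl, σ, hσ, by simp [ht0, hs0]⟩
    · refine ⟨t + s, h.le, (t / (t + s)) • σ + (s / (t + s)) • τ,
        convex_convexHull ℝ _ hσ hτ (by positivity) (by positivity) (by field_simp), ?_⟩
      rw [smul_add, smul_smul, smul_smul, mul_div_cancel₀ _ h.ne', mul_div_cancel₀ _ h.ne']

theorem mem_sepStates_of_mem_sepCone [Nonempty A] [Nonempty B] {X : BipOp A B}
    (hX : X ∈ sepCone A B) (htr : X.trace = 1) : X ∈ sepStates A B := by
  obtain ⟨t, ht, σ, hσ, rfl⟩ := exists_eq_smul_sepStates hX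
  rw [Matrix.trace_smul, (sepStates_subset hσ).2, Complex.real_smul, mul_one,
    Complex.ofReal_eq_one] at htr
  rwa [htr, one_smul]

theorem sepStates_subset_pptPlusStates : sepStates A B ⊆ pptPlusStates A B := fun _ hX =>
  ⟨(sepStates_subset hX).2, posSemidef_of_mem_sepCone (sepStates_subset hX).1,
    posSemidef_of_mem_sepCone (partialTranspose_mem_sepCone (sepStates_subset hX).1)⟩

theorem pptPlusStates_subset_rainsSet [DecidableEq A] [DecidableEq B] :
    pptPlusStates A B ⊆ rainsSet A B := fun X hX => by
  refine ⟨hX.2.1, ?_⟩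
  have := traceNorm_sub_le hX.2.2 PosSemidef.zero
  simpa [hX.1] using this

end Separable

/-! ### Channels through their Choi matrices, and inclusions between the classes. -/

section Operations

variable {A B A' B' : Type} [Fintype A] [Fintype B]

/-- The action of the map with Choi matrix `C` on `X`. -/
def choiApply (C : BipOp (A × A') (B × B')) (X : BipOp A B) : BipOp A' B' :=
  Matrix.of fun i j => ∑ a, ∑ b,
    X a b * C ((a.1, i.1), (a.2, i.2)) ((b.1, j.1), (b.2, j.2))

theorem choiApply_choi [DecidableEq A] [DecidableEq B] (Λ : BipMap A B A' B') (X : BipOp A B) :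
    choiApply (choi Λ) X = Λ X := by
  conv_rhs => rw [Matrix.matrix_eq_sum_single X]
  ext i j
  simp only [choiApply, choi, Matrix.of_apply, map_sum, Matrix.sum_apply]
  refine Finset.sum_congr rfl fun a _ => Finset.sum_congr rfl fun b _ => ?_
  have : single a b (X a b) = X a b • single a b (1 : ℂ) := by
    rw [Matrix.smul_single, smul_eq_mul, mul_one]
  rw [this, map_smul, Matrix.smul_apply, smul_eq_mul]

theorem choiApply_add_left (C D : BipOp (A × A') (B × B')) (X : BipOp A B) :
    choiApply (C + D) X = choiApply C X + choiApply D X := by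
  ext i j
  simp [choiApply, mul_add, Finset.sum_add_distrib]

theorem choiApply_add_right (C : BipOp (A × A') (B × B')) (X Y : BipOp A B) :
    choiApply C (X + Y) = choiApply C X + choiApply C Y := by
  ext i j
  simp [choiApply, add_mul, Finset.sum_add_distrib]

/-- A product Choi vector acts as a product Kraus operator, so product vectors stay product. By
bilinearity, separable Choi matrices preserve the separable cone. -/
theorem choiApply_prodProj (α : A × A' → ℂ) (β : B × B' → ℂ) (φ : A → ℂ) (η : B → ℂ) :
    choiApply (prodProj α β) (prodProj φ η) =
      prodProj (fun i => ∑ a, α (a, i) * φ a) (fun i => ∑ b, β (b, i) * η b) := by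
  ext i j
  have hfac : ∀ (α : A × A' → ℂ) (β : B × B' → ℂ) (φ : A → ℂ) (η : B → ℂ) (i : A' × B'),
      ∑ a : A × B, α (a.1, i.1) * φ a.1 * (β (a.2, i.2) * η a.2)
        = (∑ a, α (a, i.1) * φ a) * ∑ b, β (b, i.2) * η b := fun α β φ η i => by
    rw [Fintype.sum_prod_type, Finset.sum_mul_sum]
  rw [prodProj_apply, ← hfac, mul_comm (star _), ← star_mul, ← hfac, star_sum, Finset.sum_mul_sum]
  refine Finset.sum_congr rfl fun a _ => Finset.sum_congr rfl fun b _ => ?_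
  simp only [prodProj_apply, star_mul']
  ring

theorem choiApply_mem_sepCone {C : BipOp (A × A') (B × B')} (hC : C ∈ sepCone (A × A') (B × B'))
    {X : BipOp A B} (hX : X ∈ sepCone A B) : choiApply C X ∈ sepCone A' B' := by
  induction hC using sepCone_induction with
  | prod α β =>
    induction hX using sepCone_induction with
    | prod φ η => rw [choiApply_prodProj]; exact prodProj_mem_sepCone _ _
    | zero => convert zero_mem (sepCone A' B'); ext i j; simp [choiApply]
    | add X Y _ _ hX hY => rw [choiApply_add_right]; exact add_mem hX hY
  | zero => convert zero_mem (sepCone A' B'); ext i j; simp [choiApply]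
  | add C D _ _ hC hD => rw [choiApply_add_left]; exact add_mem hC hD

theorem partialTranspose_choiApply (C : BipOp (A × A') (B × B')) (X : BipOp A B) :
    partialTranspose (choiApply C X) = choiApply (partialTranspose C) (partialTranspose X) := by
  ext i j
  simp only [partialTranspose_apply, choiApply, Matrix.of_apply, Fintype.sum_prod_type]
  refine Finset.sum_congr rfl fun a _ => ?_
  rw [Finset.sum_comm]
  conv_rhs => rw [Finset.sum_comm]
  refine Finset.sum_congr rfl fun b _ => ?_
  rw [Finset.sum_comm]

variable [Fintype A'] [Fintype B']

theorem posSemidef_choiApply {C : BipOp (A × A') (B × B')} (hC : C.PosSemidef) {X : BipOp A B}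
    (hX : X.PosSemidef) : (choiApply C X).PosSemidef := by
  classical
  obtain ⟨D, rfl⟩ := exists_eq_conjTranspose_mul_self hC
  -- The conjugated rows of `D`, reshaped into matrices, are Kraus operators for the map.
  let K : (A × A') × (B × B') → Matrix (A' × B') (A × B) ℂ := fun x =>
    Matrix.of fun i a => star (D x ((a.1, i.1), (a.2, i.2)))
  have : choiApply (Dᴴ * D) X = ∑ x, K x * X * (K x)ᴴ := by
    ext i j
    simp only [choiApply, Matrix.sum_apply, Matrix.mul_apply, Matrix.of_apply,
      conjTranspose_apply, K, star_star, Finset.mul_sum, Finset.sum_mul]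
    rw [Finset.sum_comm]
    conv_rhs => rw [Finset.sum_comm]
    refine Finset.sum_congr rfl fun b _ => ?_
    rw [Finset.sum_comm]
    refine Finset.sum_congr rfl fun x _ => Finset.sum_congr rfl fun a _ => ?_
    ring
  rw [this]
  exact posSemidef_sum _ fun x _ => hX.mul_mul_conjTranspose_same _

variable [DecidableEq A] [DecidableEq B]

theorem choi_mem_sepCone {Λ : BipMap A B A' B'} (hΛ : Λ ∈ sepOps A B A' B') :
    choi Λ ∈ sepCone (A × A') (B × B') := by
  obtain ⟨-, t, ht, σ, hσ, h⟩ := hΛ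
  rw [h]
  exact smul_mem_sepCone (sepStates_subset hσ).1 ht

theorem sepOps_subset_pptOps : sepOps A B A' B' ⊆ pptOps A B A' B' := fun _ hΛ =>
  ⟨hΛ.1, posSemidef_of_mem_sepCone (partialTranspose_mem_sepCone (choi_mem_sepCone hΛ))⟩

theorem sepOps_subset_sepPreservingOps [Nonempty A'] [Nonempty B'] :
    sepOps A B A' B' ⊆ sepPreservingOps A B A' B' := fun Λ hΛ => by
  refine ⟨hΛ.1, fun σ hσ => mem_sepStates_of_mem_sepCone ?_ ?_⟩
  · rw [← choiApply_choi]
    exact choiApply_mem_sepCone (choi_mem_sepCone hΛ) (sepStates_subset hσ).1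
  · rw [hΛ.1.tracePreserving, (sepStates_subset hσ).2]

theorem IsCPTP.posSemidef {n n' : Type} [Fintype n] [Fintype n']
    {Λ : Matrix n n ℂ →ₗ[ℂ] Matrix n' n' ℂ} (hΛ : IsCPTP Λ) {X : Matrix n n ℂ}
    (hX : X.PosSemidef) : (Λ X).PosSemidef :=
  (hΛ.completelyPositive 1 _ (hX.submatrix Prod.snd)).submatrix fun i => (0, i)

/-- Conjugating `Λ` by partial transposition gives the map whose Choi matrix is the partial
transpose of `choi Λ`, which is positive semidefinite for a PPT operation. -/
theorem posSemidef_partialTranspose_map {Λ : BipMap A B A' B'} (hΛ : Λ ∈ pptOps A B A' B')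
    {Y : BipOp A B} (hY : Y.PosSemidef) :
    (partialTranspose (Λ (partialTranspose Y))).PosSemidef := by
  rw [← choiApply_choi, partialTranspose_choiApply, partialTranspose_partialTranspose]
  exact posSemidef_choiApply hΛ.2 hY

theorem pptOps_subset_pptPlusPreservingOps :
    pptOps A B A' B' ⊆ pptPlusPreservingOps A B A' B' := fun _ hΛ =>
  ⟨hΛ.1, fun _ hσ => ⟨(hΛ.1.tracePreserving _).trans hσ.1, hΛ.1.posSemidef hσ.2.1,
    posSemidef_partialTranspose_map hΛ hσ.2.2⟩⟩

/-- The conjugated map is positive and trace-preserving. It carries the Jordan decomposition of the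
partial transpose to a decomposition with the same traces, so the trace norm cannot grow. -/
theorem pptOps_subset_rainsPreservingOps [DecidableEq A'] [DecidableEq B'] :
    pptOps A B A' B' ⊆ rainsPreservingOps A B A' B' := fun Λ hΛ => by
  refine ⟨hΛ.1, fun X hX => ⟨hΛ.1.posSemidef hX.1, ?_⟩⟩
  obtain ⟨P, Q, hP, hQ, h, htr⟩ :=
    exists_posSemidef_sub_eq (isHermitian_partialTranspose hX.1.isHermitian)
  have hX' : X = partialTranspose P - partialTranspose Q := by
    rw [← partialTranspose_sub, ← h, partialTranspose_partialTranspose]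
  rw [hX', map_sub, partialTranspose_sub]
  refine (traceNorm_sub_le (posSemidef_partialTranspose_map hΛ hP)
    (posSemidef_partialTranspose_map hΛ hQ)).trans ?_
  rw [trace_partialTranspose, trace_partialTranspose, hΛ.1.tracePreserving,
    hΛ.1.tracePreserving, trace_partialTranspose, trace_partialTranspose, htr]
  exact hX.2

end Operations

/-! ### Separability of the isotropic states with `f ≤ 1/d`, by phase averaging. -/

section Isotropic

theorem maxEnt_apply (m : ℕ) (p q : Fin m × Fin m) :
    maxEnt m p q = if p.1 = p.2 ∧ q.1 = q.2 then (1 / m : ℂ) else 0 := by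
  have h : ((Real.sqrt m : ℝ) : ℂ) * ((Real.sqrt m : ℝ) : ℂ) = m := by
    rw [← Complex.ofReal_mul, Real.mul_self_sqrt (Nat.cast_nonneg m), Complex.ofReal_natCast]
  by_cases h₁ : p.1 = p.2 <;> by_cases h₂ : q.1 = q.2 <;>
    simp [maxEnt, maxEntVec, vecMulVec_apply, h₁, h₂, ← h]

theorem trace_maxEnt {m : ℕ} (hm : 1 ≤ m) : (maxEnt m).trace = 1 := by
  have : (m : ℂ) ≠ 0 := by exact_mod_cast (by omega : m ≠ 0)
  simp [Matrix.trace, maxEnt_apply, Fintype.sum_prod_type, this]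

theorem trace_isotropic {d : ℕ} (hd : 2 ≤ d) (f : ℝ) : (isotropic d f).trace = 1 := by
  have h1 : ((d : ℂ) ^ 2 - 1) ≠ 0 := by
    have : ((d : ℝ) ^ 2 - 1) ≠ 0 := by
      have : (2 : ℝ) ≤ d := by exact_mod_cast hd
      nlinarith
    exact_mod_cast this
  simp only [isotropic, Matrix.trace_add, Matrix.trace_smul, Matrix.trace_sub, Matrix.trace_one,
    trace_maxEnt (show 1 ≤ d by omega), Complex.real_smul, Fintype.card_prod, Fintype.card_fin]
  push_cast
  field_simp
  ring

/-- Averaging over independent cubic phases selects the index pairs `{j, n} = {k, l}`. -/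
theorem sum_phase {ι : Type} [Fintype ι] [DecidableEq ι] (j k l n : ι) :
    ∑ θ : ι → ZMod 3, ZMod.stdAddChar (θ j - θ k - θ l + θ n) =
      if (j = k ∧ l = n) ∨ (j = l ∧ k = n) then (3 ^ Fintype.card ι : ℂ) else 0 := by
  split_ifs with h
  · have : ∀ θ : ι → ZMod 3, θ j - θ k - θ l + θ n = 0 := fun θ => by
      rcases h with ⟨rfl, rfl⟩ | ⟨rfl, rfl⟩ <;> ring
    simp [this, AddChar.map_zero_eq_one, ZMod.card]
  · obtain ⟨η, hη⟩ : ∃ η : ι → ZMod 3, η j - η k - η l + η n ≠ 0 := by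
      by_cases hjk : j = k
      · subst hjk
        have hnl : ¬ l = n := fun e => h (Or.inl ⟨rfl, e⟩)
        exact ⟨Pi.single n 1, by simp [Pi.single_apply, hnl]⟩
      by_cases hjl : j = l
      · subst hjl
        have hnk : ¬ k = n := fun e => h (Or.inr ⟨rfl, e⟩)
        exact ⟨Pi.single n 1, by simp [Pi.single_apply, hnk]⟩
      -- The phase is `1` or, if `n = j`, `2`. Both are nonzero modulo 3; signs modulo 2 would fail
      -- here.
      refine ⟨Pi.single j 1, ?_⟩
      rw [Pi.single_eq_same, Pi.single_eq_of_ne (Ne.symm hjk), Pi.single_eq_of_ne (Ne.symm hjl),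
        Pi.single_apply]
      split_ifs <;> decide
    set S := ∑ θ : ι → ZMod 3, ZMod.stdAddChar (θ j - θ k - θ l + θ n) with hS
    have hshift : ZMod.stdAddChar (η j - η k - η l + η n) * S = S := by
      rw [hS, Finset.mul_sum]
      refine Fintype.sum_equiv (Equiv.addLeft η) _ _ fun θ => ?_
      rw [← AddChar.map_add_eq_mul]
      congr 1
      simp only [Equiv.coe_addLeft, Pi.add_apply]
      ring
    have hne : ZMod.stdAddChar (η j - η k - η l + η n) ≠ (1 : ℂ) := fun e =>
      hη (ZMod.injective_stdAddChar (e.trans (AddChar.map_zero_eq_one _).symm))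
    have : (ZMod.stdAddChar (η j - η k - η l + η n) - 1) * S = 0 := by
      rw [sub_mul, hshift, one_mul, sub_self]
    exact (mul_eq_zero.1 this).resolve_left (sub_ne_zero.2 hne)

/-- The phase average of the projector onto `∑ j |j⟩ ⊗ ∑ k v k |k⟩`. -/
def phaseTwirl {ι : Type} [DecidableEq ι] (v : ι → ℂ) : BipOp ι ι :=
  Matrix.of fun p q => if (p.1 = p.2 ∧ q.1 = q.2) ∨ p = q then v p.2 * star (v q.2) else 0

theorem phaseTwirl_mem_sepCone {ι : Type} [Fintype ι] [DecidableEq ι] (v : ι → ℂ) :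
    phaseTwirl v ∈ sepCone ι ι := by
  have h : phaseTwirl v = ((3 ^ Fintype.card ι : ℝ)⁻¹) • ∑ θ : ι → ZMod 3,
      prodProj (fun j => ZMod.stdAddChar (θ j)) (fun k => ZMod.stdAddChar (-θ k) * v k) := by
    ext p q
    have hterm : ∀ θ : ι → ZMod 3,
        prodProj (fun j => ZMod.stdAddChar (θ j)) (fun k => ZMod.stdAddChar (-θ k) * v k) p q =
          ZMod.stdAddChar (θ p.1 - θ p.2 - θ q.1 + θ q.2) * (v p.2 * star (v q.2)) := fun θ => by
      have hstar : ∀ x : ZMod 3, star (ZMod.stdAddChar x : ℂ) = ZMod.stdAddChar (-x) :=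
        fun x => (AddChar.map_neg_eq_conj _ x).symm
      rw [prodProj_apply, star_mul', hstar, hstar, neg_neg, sub_eq_add_neg, sub_eq_add_neg]
      simp only [AddChar.map_add_eq_mul]
      ring
    rw [Matrix.smul_apply, Matrix.sum_apply, Finset.sum_congr rfl fun θ _ => hterm θ,
      ← Finset.sum_mul, sum_phase]
    simp only [phaseTwirl, Matrix.of_apply, Prod.ext_iff]
    split_ifs
    · simp
    · simp
  rw [h]
  exact smul_mem_sepCone (sum_mem fun θ _ => prodProj_mem_sepCone _ _) (by positivity)

theorem diagonal_mem_sepCone {ι κ : Type} [Fintype ι] [Fintype κ] [DecidableEq ι] [DecidableEq κ]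
    {w : ι × κ → ℝ} (hw : ∀ p, 0 ≤ w p) :
    (diagonal fun p => (w p : ℂ)) ∈ sepCone ι κ := by
  have h : (diagonal fun p => (w p : ℂ)) =
      ∑ x : ι × κ, w x • prodProj (Pi.single x.1 1) (Pi.single x.2 1) := by
    ext p q
    have : ∀ x : ι × κ, (w x • prodProj (Pi.single x.1 (1 : ℂ)) (Pi.single x.2 (1 : ℂ))) p q =
        if x = p then (if p = q then (w p : ℂ) else 0) else 0 := fun x => by
      simp only [Matrix.smul_apply, prodProj_apply, Pi.single_apply, Complex.real_smul,
        Prod.ext_iff]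
      grind [star_one, star_zero]
    rw [Matrix.sum_apply, Finset.sum_congr rfl fun x _ => this x]
    simp [diagonal_apply]
  rw [h]
  exact sum_mem fun x _ => smul_mem_sepCone (prodProj_mem_sepCone _ _) (hw x)

/-- The twirl of the all-ones vector counts each diagonal entry at `|ii⟩` once instead of twice; the
diagonal term supplies the missing copy. -/
theorem smul_maxEnt_add_one_mem_sepCone {d : ℕ} (hd : 1 ≤ d) :
    (d : ℝ) • maxEnt d + 1 ∈ sepCone (Fin d) (Fin d) := by
  have h0 : (d : ℂ) ≠ 0 := by exact_mod_cast (by omega : d ≠ 0)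
  have h : (d : ℝ) • maxEnt d + 1 = phaseTwirl (fun _ : Fin d => 1) +
      diagonal fun p : Fin d × Fin d => ((if p.1 = p.2 then 1 else 0 : ℝ) : ℂ) := by
    ext p q
    simp only [Matrix.add_apply, Matrix.smul_apply, maxEnt_apply, phaseTwirl, Matrix.of_apply,
      Matrix.one_apply, diagonal_apply, Complex.real_smul]
    by_cases hp : p.1 = p.2 <;> by_cases hq : q.1 = q.2 <;> by_cases hpq : p = q <;>
      simp_all
  rw [h]
  exact add_mem (phaseTwirl_mem_sepCone _)
    (diagonal_mem_sepCone fun p => by split_ifs <;> norm_num)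

theorem one_sub_maxEnt_mem_sepCone {d : ℕ} (hd : 1 ≤ d) :
    1 - maxEnt d ∈ sepCone (Fin d) (Fin d) := by
  have h0 : (d : ℂ) ≠ 0 := by exact_mod_cast (by omega : d ≠ 0)
  -- The projectors onto these differences sum to `2d` times the identity minus twice the all-ones
  -- matrix, which is `2d (1 - Ψ_d)` on the span of the `|ii⟩`. The other diagonal entries come out
  -- as `2d - 2` and are topped up by `2`.
  let v : Fin d → Fin d → Fin d → ℂ := fun j k => Pi.single j 1 - Pi.single k 1
  have hv : ∀ a b, ∑ j, ∑ k, v j k a * star (v j k b) = 2 * d * (if a = b then 1 else 0) - 2 := by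
    intro a b
    have : ∀ j k : Fin d, v j k a * star (v j k b) =
        (if a = j then if b = j then 1 else 0 else 0) - (if a = j then 1 else 0) *
          (if b = k then 1 else 0) - (if a = k then 1 else 0) * (if b = j then 1 else 0)
        + (if a = k then if b = k then 1 else 0 else 0) := fun j k => by
      simp only [v, Pi.sub_apply, Pi.single_apply, star_sub]
      split_ifs <;> simp
    simp only [this, Finset.sum_add_distrib, Finset.sum_sub_distrib, ← Finset.mul_sum,
      ← Finset.sum_mul]
    simp [Finset.sum_ite_eq, eq_comm (a := b)]
    split_ifs <;> ring
  have h : 1 - maxEnt d = ((2 * d : ℝ)⁻¹) • (∑ j, ∑ k, phaseTwirl (v j k) +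
      diagonal fun p : Fin d × Fin d => ((if p.1 = p.2 then 0 else 2 : ℝ) : ℂ)) := by
    ext p q
    have hsum : (∑ j, ∑ k, phaseTwirl (v j k)) p q =
        if (p.1 = p.2 ∧ q.1 = q.2) ∨ p = q then
          2 * (d : ℂ) * (if p.2 = q.2 then 1 else 0) - 2 else 0 := by
      simp only [Matrix.sum_apply, phaseTwirl, Matrix.of_apply]
      split_ifs
      all_goals first | simp; done | skip
      all_goals rw [hv]; simp [*]
    rw [Matrix.smul_apply, Matrix.add_apply, hsum]
    simp only [Matrix.sub_apply, maxEnt_apply, Matrix.one_apply, diagonal_apply,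
      Complex.real_smul, Prod.ext_iff]
    push_cast
    split_ifs <;> first | (exfalso; grind) | (simp; try field_simp; try ring)
  rw [h]
  exact smul_mem_sepCone (add_mem (sum_mem fun j _ => sum_mem fun k _ => phaseTwirl_mem_sepCone _)
    (diagonal_mem_sepCone fun p => by split_ifs <;> norm_num)) (by positivity)

theorem isotropic_mem_sepStates {d : ℕ} (hd : 2 ≤ d) {f : ℝ} (hf0 : 0 ≤ f)
    (hf : f ≤ 1 / (d : ℝ)) : isotropic d f ∈ sepStates (Fin d) (Fin d) := by
  have : NeZero d := ⟨by omega⟩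
  have hd' : (2 : ℝ) ≤ d := by exact_mod_cast hd
  have h1 : 0 < (d : ℝ) ^ 2 - 1 := by nlinarith
  refine mem_sepStates_of_mem_sepCone ?_ (trace_isotropic hd f)
  -- The two operators on the right are separable, and the second coefficient is nonnegative exactly
  -- when `f ≤ 1/d`.
  have h : isotropic d f = (f / (d + 1)) • ((d : ℝ) • maxEnt d + 1) +
      ((1 - d * f) / ((d : ℝ) ^ 2 - 1)) • (1 - maxEnt d) := by
    have h2 : (d : ℝ) ^ 2 - 1 = (d - 1) * (d + 1) := by ring
    have h3 : (d : ℝ) - 1 ≠ 0 := by linarith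
    have h4 : (d : ℝ) + 1 ≠ 0 := by linarith
    rw [isotropic, h2]
    have e1 : f = f / (d + 1) * d + f / (d + 1) := by field_simp
    have e2 : (1 - f) / ((d - 1 : ℝ) * (d + 1))
        = f / (d + 1) + (1 - d * f) / ((d - 1 : ℝ) * (d + 1)) := by
      field_simp
      ring
    rw [e2]
    nth_rewrite 1 [e1]
    module
  rw [h]
  refine add_mem (smul_mem_sepCone (smul_maxEnt_add_one_mem_sepCone (by omega)) (by positivity))
    (smul_mem_sepCone (one_sub_maxEnt_mem_sepCone (by omega)) (div_nonneg ?_ h1.le))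
  rw [le_div_iff₀ (by linarith)] at hf
  linarith

end Isotropic

/-! ### Overlap with `Ψ_m`, and its bound on the Rains set through the swap operator. -/

section Fidelity

/-- The overlap with the maximally entangled state. -/
noncomputable def fidelity (m : ℕ) (X : BipOp (Fin m) (Fin m)) : ℝ :=
  ((X.conjTranspose * maxEnt m).trace).re

theorem fidelity_eq (m : ℕ) (X : BipOp (Fin m) (Fin m)) :
    fidelity m X = 1 / m * ∑ i, ∑ j, (X (i, i) (j, j)).re := by
  have h : (X.conjTranspose * maxEnt m).trace = ∑ j, ∑ i, star (X (i, i) (j, j)) * (1 / m : ℂ) := by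
    simp [Matrix.trace, Matrix.mul_apply, maxEnt_apply, Fintype.sum_prod_type, ite_and]
  rw [fidelity, h, Finset.sum_comm, Complex.re_sum, Finset.mul_sum]
  refine Finset.sum_congr rfl fun i _ => ?_
  rw [Complex.re_sum, Finset.mul_sum]
  refine Finset.sum_congr rfl fun j _ => ?_
  have : (1 / m : ℂ) = ((1 / m : ℝ) : ℂ) := by push_cast; rfl
  rw [this, Complex.re_mul_ofReal, mul_comm]
  rfl

theorem fidelity_add (m : ℕ) (X Y : BipOp (Fin m) (Fin m)) :
    fidelity m (X + Y) = fidelity m X + fidelity m Y := by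
  simp [fidelity, Matrix.add_mul]

theorem fidelity_sum (m : ℕ) {ι : Type} (s : Finset ι) (X : ι → BipOp (Fin m) (Fin m)) :
    fidelity m (∑ x ∈ s, X x) = ∑ x ∈ s, fidelity m (X x) :=
  map_sum (AddMonoidHom.mk' (fidelity m) (fidelity_add m)) X s

theorem fidelity_smul (m : ℕ) (r : ℝ) (X : BipOp (Fin m) (Fin m)) :
    fidelity m (r • X) = r * fidelity m X := by
  simp [fidelity, Matrix.conjTranspose_smul]

theorem fidelity_le_trace {m : ℕ} (hm : 1 ≤ m) {X : BipOp (Fin m) (Fin m)} (hX : X.PosSemidef) :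
    fidelity m X ≤ X.trace.re := by
  have := re_trace_mul_nonneg hX (posSemidef_of_mem_sepCone (one_sub_maxEnt_mem_sepCone hm))
  rw [Matrix.mul_sub, Matrix.mul_one, Matrix.trace_sub, Complex.sub_re] at this
  rw [fidelity, hX.isHermitian.eq]
  linarith

/-- The operator exchanging the two tensor factors. -/
def swapOp (A : Type) [DecidableEq A] : BipOp A A :=
  Matrix.of fun p q => if q = p.swap then 1 else 0

theorem conjTranspose_swapOp (A : Type) [DecidableEq A] : (swapOp A)ᴴ = swapOp A := by
  ext p q
  simp only [conjTranspose_apply, swapOp, Matrix.of_apply, Prod.ext_iff, Prod.fst_swap,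
    Prod.snd_swap]
  grind [star_one, star_zero]

theorem swapOp_mul_swapOp (A : Type) [Fintype A] [DecidableEq A] : swapOp A * swapOp A = 1 := by
  ext p q
  rw [Matrix.mul_apply, Finset.sum_eq_single p.swap]
  · simp [swapOp, Matrix.one_apply, eq_comm (a := q)]
  · intro r _ hr
    simp [swapOp, hr]
  · simp

theorem posSemidef_one_add_of_involution {n : Type} [Fintype n] [DecidableEq n] {S : Matrix n n ℂ}
    (h₁ : Sᴴ = S) (h₂ : S * S = 1) : (1 + S).PosSemidef := by
  -- For a Hermitian involution, `(1 + S) / 2` is a projection.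
  have h : 1 + S = (1 / 2 : ℝ) • ((1 + S)ᴴ * (1 + S)) := by
    rw [conjTranspose_add, h₁, conjTranspose_one, Matrix.add_mul, Matrix.mul_add, Matrix.mul_add,
      h₂, Matrix.one_mul, Matrix.one_mul, Matrix.mul_one]
    module
  rw [h]
  exact (posSemidef_conjTranspose_mul_self _).smul (by norm_num)

theorem fidelity_eq_trace_swapOp (m : ℕ) (X : BipOp (Fin m) (Fin m)) :
    fidelity m X = 1 / m * (partialTranspose X * swapOp (Fin m)).trace.re := by
  rw [fidelity_eq]
  congr 1
  have : (partialTranspose X * swapOp (Fin m)).trace = ∑ i, ∑ j, X (i, i) (j, j) := by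
    simp only [Matrix.trace, Matrix.diag, Matrix.mul_apply, swapOp, Matrix.of_apply,
      partialTranspose_apply]
    have hs : ∀ p q : Fin m × Fin m, p = q.swap ↔ q = p.swap := fun p q =>
      ⟨fun h => by rw [h, Prod.swap_swap], fun h => by rw [h, Prod.swap_swap]⟩
    simp only [hs, mul_ite, mul_one, mul_zero, Finset.sum_ite_eq', Finset.mem_univ, if_true,
      Fintype.sum_prod_type, Prod.fst_swap, Prod.snd_swap]
  simp [this]

theorem fidelity_le_of_mem_rainsSet {m : ℕ} {X : BipOp (Fin m) (Fin m)}
    (hX : X ∈ rainsSet (Fin m) (Fin m)) : fidelity m X ≤ 1 / m := by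
  obtain ⟨P, Q, hP, hQ, h, htr⟩ :=
    exists_posSemidef_sub_eq (isHermitian_partialTranspose hX.1.isHermitian)
  rw [fidelity_eq_trace_swapOp, h]
  have hS := conjTranspose_swapOp (Fin m)
  have hSS := swapOp_mul_swapOp (Fin m)
  have key := re_trace_sub_mul_le hP hQ
    (sub_eq_add_neg (1 : BipOp (Fin m) (Fin m)) _ ▸ posSemidef_one_add_of_involution
      (S := -swapOp (Fin m)) (by rw [conjTranspose_neg, hS]) (by rw [neg_mul_neg, hSS]))
    (posSemidef_one_add_of_involution hS hSS)
  exact mul_le_of_le_one_right (by positivity) (key.trans (htr.le.trans hX.2))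

end Fidelity

/-! ### Separable channels built from product Kraus operators. -/

section Kraus

open scoped Kronecker

variable {ι : Type} [Fintype ι]

/-- The map `X ↦ ∑ x, K x * X * (K x)ᴴ`. -/
def krausMap {n n' : Type} [Fintype n] (K : ι → Matrix n' n ℂ) :
    Matrix n n ℂ →ₗ[ℂ] Matrix n' n' ℂ where
  toFun X := ∑ x, K x * X * (K x)ᴴ
  map_add' X Y := by simp only [Matrix.mul_add, Matrix.add_mul, Finset.sum_add_distrib]
  map_smul' c X := by
    simp only [Matrix.mul_smul, Matrix.smul_mul, Finset.smul_sum, RingHom.id_apply]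

theorem krausMap_apply {n n' : Type} [Fintype n] (K : ι → Matrix n' n ℂ) (X : Matrix n n ℂ) :
    krausMap K X = ∑ x, K x * X * (K x)ᴴ := rfl

theorem isCPTP_krausMap {n n' : Type} [Fintype n] [Fintype n'] [DecidableEq n]
    (K : ι → Matrix n' n ℂ) (hK : ∑ x, (K x)ᴴ * K x = 1) : IsCPTP (krausMap K) where
  completelyPositive k M hM := by
    have h : ampliation k (krausMap K) M = ∑ x,
        ((1 : Matrix (Fin k) (Fin k) ℂ) ⊗ₖ K x) * M * ((1 : Matrix (Fin k) (Fin k) ℂ) ⊗ₖ K x)ᴴ := by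
      ext p q
      simp [ampliation, krausMap_apply, Matrix.sum_apply, Matrix.mul_apply, Fintype.sum_prod_type,
        kroneckerMap_apply, Matrix.one_apply, ite_mul, apply_ite]
    rw [h]
    exact posSemidef_sum _ fun x _ => hM.mul_mul_conjTranspose_same _
  tracePreserving M := by
    rw [krausMap_apply, Matrix.trace_sum]
    simp only [Matrix.trace_mul_cycle (K _) M]
    rw [← Matrix.trace_sum, ← Finset.sum_mul, hK, Matrix.one_mul]

variable {A B A' B' : Type} [DecidableEq A] [DecidableEq B]

theorem conjTranspose_single_mul_single [Fintype A'] [DecidableEq A'] (i : A') (a : A) (c : ℂ) :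
    (Matrix.single i a c)ᴴ * Matrix.single i a c = diagonal (Pi.single a (star c * c)) := by
  rw [Matrix.conjTranspose_single, Matrix.single_mul_single_same, Matrix.diagonal_single]

/-- The matrix `∑ i, c |i⟩⟨e i|`. -/
def selectMatrix {m : ℕ} (e : Fin m → A) (c : ℂ) : Matrix (Fin m) A ℂ :=
  Matrix.of fun i a => if e i = a then c else 0

/-- The indicator function of the range of `e`. -/
def rangeIndicator {m : ℕ} (e : Fin m → A) (a : A) : ℂ := if ∃ i, e i = a then 1 else 0

theorem rangeIndicator_eq_sum {m : ℕ} {e : Fin m → A} (he : Function.Injective e) (a : A) :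
    rangeIndicator e a = ∑ i, if e i = a then 1 else 0 := by
  rw [rangeIndicator]
  split_ifs with h
  · obtain ⟨i, rfl⟩ := h
    simp [he.eq_iff]
  · push Not at h
    simp [h]

theorem star_rangeIndicator_mul {m : ℕ} (e : Fin m → A) (a : A) :
    star (rangeIndicator e a) * rangeIndicator e a = rangeIndicator e a := by
  rw [rangeIndicator]
  split_ifs <;> simp

theorem star_one_sub_rangeIndicator_mul {m : ℕ} (e : Fin m → A) (a : A) :
    star (1 - rangeIndicator e a) * (1 - rangeIndicator e a) = 1 - rangeIndicator e a := by
  rw [rangeIndicator]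
  split_ifs <;> simp

theorem conjTranspose_selectMatrix_mul {m : ℕ} {e : Fin m → A} (he : Function.Injective e)
    (c : ℂ) : (selectMatrix e c)ᴴ * selectMatrix e c =
      diagonal fun a => star c * c * rangeIndicator e a := by
  ext a b
  simp only [Matrix.mul_apply, conjTranspose_apply, selectMatrix, Matrix.of_apply, diagonal_apply]
  by_cases hab : a = b
  · subst hab
    rw [if_pos rfl, rangeIndicator_eq_sum he, Finset.mul_sum]
    refine Finset.sum_congr rfl fun i _ => ?_
    split_ifs <;> simp
  · rw [if_neg hab]
    refine Finset.sum_eq_zero fun i _ => ?_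
    split_ifs with h₁ h₂
    · exact absurd (h₁.symm.trans h₂) hab
    all_goals simp

variable [Fintype A] [Fintype B]

theorem choi_krausMap (S : ι → Matrix A' A ℂ) (T : ι → Matrix B' B ℂ) :
    choi (krausMap fun x => S x ⊗ₖ T x) =
      ∑ x, prodProj (fun p : A × A' => S x p.2 p.1) (fun p : B × B' => T x p.2 p.1) := by
  ext p q
  simp only [choi, krausMap_apply, Matrix.sum_apply, Matrix.of_apply, prodProj_apply]
  refine Finset.sum_congr rfl fun x _ => ?_
  rw [Matrix.mul_assoc, Matrix.mul_apply, Finset.sum_eq_single (p.1.1, p.2.1),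
    Matrix.single_mul_apply_same]
  · simp [kroneckerMap_apply, conjTranspose_apply]
  · intro b _ hb
    rw [Matrix.single_mul_apply_of_ne _ _ _ _ _ hb, mul_zero]
  · simp

/-- A channel with product Kraus operators is separable. The completeness relation is stated for
Kraus operators with diagonal `(S x)ᴴ * S x` and `(T x)ᴴ * T x`. -/
theorem krausMap_mem_sepOps [Fintype A'] [Fintype B'] [Nonempty A] [Nonempty B] [Nonempty A']
    [Nonempty B']
    (S : ι → Matrix A' A ℂ) (T : ι → Matrix B' B ℂ) (α : ι → A → ℂ) (β : ι → B → ℂ)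
    (hS : ∀ x, (S x)ᴴ * S x = diagonal (α x)) (hT : ∀ x, (T x)ᴴ * T x = diagonal (β x))
    (h : ∀ a b, ∑ x, α x a * β x b = 1) :
    krausMap (fun x => S x ⊗ₖ T x) ∈ sepOps A B A' B' := by
  refine ⟨isCPTP_krausMap _ ?_, exists_eq_smul_sepStates ?_⟩
  · have : ∀ x, (S x ⊗ₖ T x)ᴴ * (S x ⊗ₖ T x) = diagonal fun p : A × B => α x p.1 * β x p.2 :=
      fun x => by
        rw [conjTranspose_kronecker, ← mul_kronecker_mul, hS, hT, diagonal_kronecker_diagonal]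
    simp only [this]
    ext p q
    by_cases hpq : p = q
    · subst hpq
      simp [Matrix.sum_apply, h]
    · simp [Matrix.sum_apply, hpq]
  · rw [choi_krausMap]
    exact sum_mem fun x _ => prodProj_mem_sepCone _ _

/-- The output is a multiple of `|ii⟩⟨ii|`, whose overlap with `Ψ_m` is `1/m`. -/
theorem fidelity_single_kraus {m : ℕ} (i : Fin m) (a : A) (b : B) (c e : ℂ) (X : BipOp A B) :
    fidelity m ((Matrix.single i a c ⊗ₖ Matrix.single i b e) * X *
      (Matrix.single i a c ⊗ₖ Matrix.single i b e)ᴴ) =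
        1 / m * (star c * c * (star e * e) * X (a, b) (a, b)).re := by
  have h : Matrix.single i a c ⊗ₖ Matrix.single i b e
      = Matrix.single (i, i) (a, b) (c * e) := Matrix.single_kronecker_single ..
  rw [h, Matrix.conjTranspose_single, Matrix.single_mul_mul_single, fidelity_eq]
  congr 1
  rw [Finset.sum_eq_single i, Finset.sum_eq_single i]
  · rw [Matrix.single_apply_same, star_mul']
    congr 1
    ring
  · intro j _ hj
    simp [Ne.symm hj]
  · simp
  · intro j _ hj
    simp [Ne.symm hj]
  · simp

theorem selectMatrix_kraus_apply {m : ℕ} (e : Fin m → A) (c : ℂ) (X : BipOp A A)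
    (p q : Fin m × Fin m) :
    ((selectMatrix e c ⊗ₖ selectMatrix e 1) * X * (selectMatrix e c ⊗ₖ selectMatrix e 1)ᴴ) p q =
      star c * c * X (e p.1, e p.2) (e q.1, e q.2) := by
  have h : selectMatrix e c ⊗ₖ selectMatrix e 1 =
      Matrix.of fun p a => if (e p.1, e p.2) = a then c else 0 := by
    ext p a
    simp only [kroneckerMap_apply, selectMatrix, Matrix.of_apply, Prod.ext_iff]
    split_ifs <;> simp_all
  rw [h]
  simp only [Matrix.mul_apply, Matrix.of_apply, conjTranspose_apply, ite_mul, zero_mul,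
    Finset.sum_ite_eq, Finset.mem_univ, if_true, apply_ite star, star_zero, mul_ite, mul_zero]
  ring

theorem fidelity_selectMatrix_kraus {m : ℕ} (e : Fin m → A) (c : ℂ) (X : BipOp A A) :
    fidelity m ((selectMatrix e c ⊗ₖ selectMatrix e 1) * X *
      (selectMatrix e c ⊗ₖ selectMatrix e 1)ᴴ) =
        1 / m * ∑ i, ∑ j, (star c * c * X (e i, e i) (e j, e j)).re := by
  simp only [fidelity_eq, selectMatrix_kraus_apply]

/-- Discarding the input and preparing `|00⟩` is a separable channel. -/
theorem exists_sepOps_fidelity_eq_trace [Nonempty A] [Nonempty B] {m : ℕ} (hm : 1 ≤ m) :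
    ∃ Λ ∈ sepOps A B (Fin m) (Fin m), ∀ X, fidelity m (Λ X) = 1 / m * X.trace.re := by
  have : NeZero m := ⟨by omega⟩
  refine ⟨_, krausMap_mem_sepOps (fun x : A × B => Matrix.single 0 x.1 1)
    (fun x => Matrix.single 0 x.2 1) _ _ (fun x => conjTranspose_single_mul_single _ _ _)
    (fun x => conjTranspose_single_mul_single _ _ _) fun a b => ?_, fun X => ?_⟩
  · simp [Fintype.sum_prod_type, Pi.single_apply]
  · rw [krausMap_apply, fidelity_sum, Matrix.trace, Complex.re_sum, Finset.mul_sum]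
    refine Finset.sum_congr rfl fun x _ => ?_
    rw [fidelity_single_kraus]
    simp

/-- For subsets `range (e k)` of size `m` covering every index equally often, one party measures
which subset it is in; if the other party is in the same subset they keep their states, and
otherwise they prepare `|00⟩`. This channel is separable. -/
theorem exists_sepOps_fidelity_eq_sum [Nonempty A] {m : ℕ} (hm : 1 ≤ m) (e : A → Fin m → A)
    (he : ∀ k, Function.Injective (e k)) (he' : ∀ i, Function.Bijective fun k => e k i) :
    ∃ Λ ∈ sepOps A A (Fin m) (Fin m), ∀ X, fidelity m (Λ X) = 1 / (m : ℝ) ^ 2 *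
      (∑ k, ∑ i, ∑ j, (X (e k i, e k i) (e k j, e k j)).re + ∑ k, ∑ a, ∑ b,
        (rangeIndicator (e k) a * (1 - rangeIndicator (e k) b) * X (a, b) (a, b)).re) := by
  have : NeZero m := ⟨by omega⟩
  have hm0 : (m : ℂ) ≠ 0 := by exact_mod_cast (by omega : m ≠ 0)
  -- Each index lies in exactly `m` of the subsets, so weight `1/m` makes the first party's
  -- measurement complete.
  obtain ⟨c, hc⟩ : ∃ c : ℂ, star c * c = ((1 / m : ℝ) : ℂ) :=
    ⟨(Real.sqrt (1 / m) : ℝ), by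
      rw [Complex.star_def, Complex.conj_ofReal, ← Complex.ofReal_mul,
        Real.mul_self_sqrt (by positivity)]⟩
  -- The left summand is success in subset `k`. The right one is failure `(k, a, b)`: the parties
  -- hold `a` in subset `k` and `b` outside it, and both reset to `0`.
  let S : A ⊕ (A × A × A) → Matrix (Fin m) A ℂ := Sum.elim (fun k => selectMatrix (e k) c)
    fun x => Matrix.single 0 x.2.1 (c * rangeIndicator (e x.1) x.2.1)
  let T : A ⊕ (A × A × A) → Matrix (Fin m) A ℂ := Sum.elim (fun k => selectMatrix (e k) 1)
    fun x => Matrix.single 0 x.2.2 (1 - rangeIndicator (e x.1) x.2.2)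
  let α : A ⊕ (A × A × A) → A → ℂ := Sum.elim
    (fun k a => star c * c * rangeIndicator (e k) a)
    fun x => Pi.single x.2.1 (star c * c * rangeIndicator (e x.1) x.2.1)
  let β : A ⊕ (A × A × A) → A → ℂ := Sum.elim (fun k a => rangeIndicator (e k) a)
    fun x => Pi.single x.2.2 (1 - rangeIndicator (e x.1) x.2.2)
  have hcr : ∀ k a, star (c * rangeIndicator (e k) a) * (c * rangeIndicator (e k) a) =
      star c * c * rangeIndicator (e k) a := fun k a => by
    rw [star_mul', mul_mul_mul_comm, star_rangeIndicator_mul]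
  refine ⟨_, krausMap_mem_sepOps S T α β ?_ ?_ ?_, fun X => ?_⟩
  · rintro (k | x)
    · exact conjTranspose_selectMatrix_mul (he k) c
    · exact (conjTranspose_single_mul_single _ _ _).trans (by rw [hcr]; rfl)
  · rintro (k | x)
    · exact (conjTranspose_selectMatrix_mul (he k) 1).trans (by simp [β])
    · exact (conjTranspose_single_mul_single _ _ _).trans
        (by rw [star_one_sub_rangeIndicator_mul]; rfl)
  · intro a b
    have hcover : ∑ k, rangeIndicator (e k) a = m := by
      simp only [rangeIndicator_eq_sum (he _)]
      rw [Finset.sum_comm]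
      have : ∀ i, ∑ k, (if e k i = a then (1 : ℂ) else 0) = 1 := fun i => by
        rw [(he' i).sum_comp (fun x => if x = a then (1 : ℂ) else 0)]
        simp
      simp [this]
    simp only [Fintype.sum_sum_type, Fintype.sum_prod_type, α, β, Sum.elim_inl, Sum.elim_inr,
      Pi.single_apply, ite_mul, mul_ite, zero_mul, mul_zero, Finset.sum_ite_eq, Finset.mem_univ,
      if_true, ← Finset.sum_add_distrib]
    have : ∀ k, star c * c * rangeIndicator (e k) a * rangeIndicator (e k) b +
        star c * c * rangeIndicator (e k) a * (1 - rangeIndicator (e k) b) =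
          star c * c * rangeIndicator (e k) a := fun k => by ring
    rw [Finset.sum_congr rfl fun k _ => this k, ← Finset.mul_sum, hcover, hc]
    push_cast
    field_simp
  · rw [krausMap_apply, fidelity_sum, Fintype.sum_sum_type]
    simp only [S, T, Sum.elim_inl, Sum.elim_inr, fidelity_selectMatrix_kraus,
      fidelity_single_kraus, hcr, star_one_sub_rangeIndicator_mul, hc, mul_assoc,
      Complex.re_ofReal_mul, Fintype.sum_prod_type, ← Finset.mul_sum]
    ring

end Kraus

/-! ### The optimal protocol and the value for any class between the two extremes. -/

section Distillation

theorem exists_sepOps_distillation {d m : ℕ} (hm : 1 ≤ m) (hmd : m ≤ d) :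
    ∃ Λ ∈ sepOps (Fin d) (Fin d) (Fin m) (Fin m), fidelity m (Λ (maxEnt d)) = 1 ∧
      fidelity m (Λ 1) = d / m * (1 + d - m) := by
  have : NeZero d := ⟨by omega⟩
  have hm0 : (m : ℝ) ≠ 0 := by exact_mod_cast (by omega : m ≠ 0)
  have hd0 : (d : ℝ) ≠ 0 := by exact_mod_cast (by omega : d ≠ 0)
  -- Cyclic windows: addition in `Fin d` wraps around, so every index is covered equally often.
  let e : Fin d → Fin m → Fin d := fun k i => k + Fin.castLE hmd i
  have he : ∀ k, Function.Injective (e k) := fun k i j h =>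
    Fin.castLE_injective hmd (add_left_cancel h)
  obtain ⟨Λ, hΛ, h⟩ := exists_sepOps_fidelity_eq_sum hm e he
    fun i => (Equiv.addRight (Fin.castLE hmd i)).bijective
  refine ⟨Λ, hΛ, ?_, ?_⟩
  · rw [h]
    -- Failure never occurs on `Ψ_d`: its outcomes satisfy `a = b`, which cannot be both inside and
    -- outside the window.
    have h₁ : ∀ k a b, rangeIndicator (e k) a * (1 - rangeIndicator (e k) b) *
        maxEnt d (a, b) (a, b) = 0 := fun k a b => by
      simp only [maxEnt_apply, and_self]
      split_ifs with hab
      · subst hab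
        rw [rangeIndicator]
        split_ifs <;> simp
      · simp
    have h₂ : (1 / d : ℂ).re = 1 / d := by
      rw [← Complex.ofReal_natCast, ← Complex.ofReal_one, ← Complex.ofReal_div, Complex.ofReal_re]
    simp only [h₁]
    simp only [maxEnt_apply, and_self, if_true, h₂]
    simp
    field_simp
  · rw [h]
    have h₁ : ∀ k, ∑ a, rangeIndicator (e k) a = m := fun k => by
      simp only [rangeIndicator_eq_sum (he k)]
      rw [Finset.sum_comm]
      simp
    have h₂ : ∀ k, ∑ a, ∑ b, (rangeIndicator (e k) a * (1 - rangeIndicator (e k) b) *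
        (1 : BipOp (Fin d) (Fin d)) (a, b) (a, b)).re = m * (d - m) := fun k => by
      simp only [Matrix.one_apply_eq, mul_one, ← Complex.re_sum, ← Finset.sum_mul_sum,
        Finset.sum_sub_distrib, h₁]
      simp
    have h₃ : ∀ k, ∑ i, ∑ j, ((1 : BipOp (Fin d) (Fin d)) (e k i, e k i) (e k j, e k j)).re =
        m := fun k => by
      simp [Matrix.one_apply, (he k).eq_iff, apply_ite]
    simp only [h₂, h₃]
    simp
    field_simp
    ring

/-- An attained bound makes the set nonempty and bounded above, so the real `sSup` is a genuine
supremum and not its default value. -/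
theorem fidelityOfDistillation_eq {A B : Type} {m : ℕ} {O : Set (BipMap A B (Fin m) (Fin m))}
    {ρ : BipOp A B} {F : ℝ} (hle : ∀ Λ ∈ O, fidelity m (Λ ρ) ≤ F)
    (hex : ∃ Λ ∈ O, fidelity m (Λ ρ) = F) : fidelityOfDistillation O ρ = F :=
  IsGreatest.csSup_eq ⟨hex, by rintro _ ⟨Λ, hΛ, rfl⟩; exact hle Λ hΛ⟩

/-- The isotropic states with `f ≥ 1 / d` lie between the one at the boundary of the separable
states and the maximally entangled state. -/
theorem isotropic_eq_maxEnt_add {d : ℕ} (hd : 2 ≤ d) (f : ℝ) :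
    isotropic d f = ((d * f - 1) / (d - 1)) • maxEnt d +
      (d * (1 - f) / (d - 1)) • isotropic d (1 / d) := by
  have hd' : (2 : ℝ) ≤ d := by exact_mod_cast hd
  have h0 : (d : ℝ) ≠ 0 := by linarith
  have h1 : (d : ℝ) - 1 ≠ 0 := by linarith
  have h2 : (d : ℝ) ^ 2 - 1 ≠ 0 := by nlinarith
  simp only [isotropic, smul_add, smul_smul, ← add_assoc, ← add_smul]
  congr 2
  · field_simp
    ring
  · field_simp

theorem fidelity_isotropic_le {d m : ℕ} (hd : 2 ≤ d) (hm : 1 ≤ m) {f : ℝ} (hf1 : f ≤ 1)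
    (hf : 1 / (d : ℝ) ≤ f) {Λ : BipMap (Fin d) (Fin d) (Fin m) (Fin m)} (hΛ : IsCPTP Λ)
    (h : fidelity m (Λ (isotropic d (1 / d))) ≤ 1 / m) :
    fidelity m (Λ (isotropic d f)) ≤
      (d * f - 1) / (d - 1) + d * (1 - f) / (m * (d - 1)) := by
  have hd' : (2 : ℝ) ≤ d := by exact_mod_cast hd
  have hmax : fidelity m (Λ (maxEnt d)) ≤ 1 := by
    have := fidelity_le_trace hm (hΛ.posSemidef (posSemidef_vecMulVec_self_star (maxEntVec d)))
    rwa [hΛ.tracePreserving, ← maxEnt, trace_maxEnt (by omega), Complex.one_re] at this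
  rw [isotropic_eq_maxEnt_add hd, map_add, fidelity_add, LinearMap.map_smul_of_tower,
    LinearMap.map_smul_of_tower, fidelity_smul, fidelity_smul]
  rw [div_le_iff₀ (by linarith)] at hf
  refine add_le_add (mul_le_of_le_one_right (div_nonneg (by linarith) (by linarith)) hmax)
    ((mul_le_mul_of_nonneg_left h (div_nonneg (by nlinarith) (by linarith))).trans_eq ?_)
  rw [div_mul_div_comm, mul_one, mul_comm ((d : ℝ) - 1)]

/-- For a class of channels containing the separable ones and mapping separable states into the
Rains set, the fidelity of distillation of the isotropic states. -/
theorem fidelityOfDistillation_isotropic {d m : ℕ} (hd : 2 ≤ d) (hm : 1 ≤ m) {f : ℝ} (hf0 : 0 ≤ f)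
    (hf1 : f ≤ 1) {O : Set (BipMap (Fin d) (Fin d) (Fin m) (Fin m))}
    (hsep : sepOps (Fin d) (Fin d) (Fin m) (Fin m) ⊆ O) (hCPTP : ∀ Λ ∈ O, IsCPTP Λ)
    (hrains : ∀ Λ ∈ O, ∀ σ ∈ sepStates (Fin d) (Fin d), Λ σ ∈ rainsSet (Fin m) (Fin m)) :
    (f ≤ 1 / (d : ℝ) → fidelityOfDistillation O (isotropic d f) = 1 / (m : ℝ)) ∧
    (m ≤ d → 1 / (d : ℝ) ≤ f →
      fidelityOfDistillation O (isotropic d f) =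
        ((d : ℝ) * f - 1) / ((d : ℝ) - 1) +
          (d : ℝ) * (1 - f) / ((m : ℝ) * ((d : ℝ) - 1))) := by
  have : NeZero d := ⟨by omega⟩
  have hd' : (2 : ℝ) ≤ d := by exact_mod_cast hd
  constructor
  · intro hf
    refine fidelityOfDistillation_eq (fun Λ hΛ =>
      fidelity_le_of_mem_rainsSet (hrains Λ hΛ _ (isotropic_mem_sepStates hd hf0 hf))) ?_
    obtain ⟨Λ, hΛ, h⟩ := exists_sepOps_fidelity_eq_trace (A := Fin d) (B := Fin d) hm
    exact ⟨Λ, hsep hΛ, by rw [h, trace_isotropic hd, Complex.one_re, mul_one]⟩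
  · intro hmd hf
    refine fidelityOfDistillation_eq (fun Λ hΛ => fidelity_isotropic_le hd hm hf1 hf (hCPTP Λ hΛ)
      (fidelity_le_of_mem_rainsSet (hrains Λ hΛ _
        (isotropic_mem_sepStates hd (by positivity) le_rfl)))) ?_
    obtain ⟨Λ, hΛ, h₁, h₂⟩ := exists_sepOps_distillation hm hmd
    refine ⟨Λ, hsep hΛ, ?_⟩
    have hiso : isotropic d f = (f - (1 - f) / ((d : ℝ) ^ 2 - 1)) • maxEnt d +
        ((1 - f) / ((d : ℝ) ^ 2 - 1)) • (1 : BipOp (Fin d) (Fin d)) := by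
      rw [isotropic]
      module
    rw [hiso, map_add, fidelity_add, LinearMap.map_smul_of_tower,
      LinearMap.map_smul_of_tower, fidelity_smul, fidelity_smul, h₁, h₂]
    have hm0 : (m : ℝ) ≠ 0 := by exact_mod_cast (by omega : m ≠ 0)
    have h3 : (d : ℝ) - 1 ≠ 0 := by linarith
    have h4 : (d : ℝ) + 1 ≠ 0 := by linarith
    rw [show (d : ℝ) ^ 2 - 1 = (d - 1) * (d + 1) by ring]
    field_simp
    ring

end Distillation

end EntDist

theorem mainTheorem4 (d m : ℕ) (hd : 2 ≤ d) (hm : 1 ≤ m) (f : ℝ) (hf0 : 0 ≤ f) (hf1 : f ≤ 1)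
    (O : Set (EntDist.BipMap (Fin d) (Fin d) (Fin m) (Fin m)))
    (hO : O ∈ ({EntDist.sepOps (Fin d) (Fin d) (Fin m) (Fin m),
        EntDist.pptOps (Fin d) (Fin d) (Fin m) (Fin m),
        EntDist.rainsPreservingOps (Fin d) (Fin d) (Fin m) (Fin m),
        EntDist.pptPlusPreservingOps (Fin d) (Fin d) (Fin m) (Fin m),
        EntDist.sepPreservingOps (Fin d) (Fin d) (Fin m) (Fin m)} :
          Set (Set (EntDist.BipMap (Fin d) (Fin d) (Fin m) (Fin m))))) :
    (f ≤ 1 / (d : ℝ) →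
      EntDist.fidelityOfDistillation O (EntDist.isotropic d f) = 1 / (m : ℝ)) ∧
    (m ≤ d → 1 / (d : ℝ) ≤ f →
      EntDist.fidelityOfDistillation O (EntDist.isotropic d f) =
        ((d : ℝ) * f - 1) / ((d : ℝ) - 1) +
          (d : ℝ) * (1 - f) / ((m : ℝ) * ((d : ℝ) - 1))) := by
  have : NeZero m := ⟨by omega⟩
  have hppt : ∀ Λ ∈ EntDist.pptOps (Fin d) (Fin d) (Fin m) (Fin m),
      ∀ σ ∈ EntDist.sepStates (Fin d) (Fin d), Λ σ ∈ EntDist.rainsSet (Fin m) (Fin m) :=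
    fun Λ hΛ σ hσ => EntDist.pptPlusStates_subset_rainsSet
      ((EntDist.pptOps_subset_pptPlusPreservingOps hΛ).2 σ
        (EntDist.sepStates_subset_pptPlusStates hσ))
  -- To send separable states into the Rains set, `SEP ⊆ PPT₊ ⊆ R` is applied to inputs, outputs or
  -- both, according to which set the class preserves.
  rcases hO with rfl | rfl | rfl | rfl | rfl
  · exact EntDist.fidelityOfDistillation_isotropic hd hm hf0 hf1 subset_rfl (fun Λ hΛ => hΛ.1)
      fun Λ hΛ => hppt Λ (EntDist.sepOps_subset_pptOps hΛ)
  · exact EntDist.fidelityOfDistillation_isotropic hd hm hf0 hf1 EntDist.sepOps_subset_pptOps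
      (fun Λ hΛ => hΛ.1) hppt
  · exact EntDist.fidelityOfDistillation_isotropic hd hm hf0 hf1
      (EntDist.sepOps_subset_pptOps.trans EntDist.pptOps_subset_rainsPreservingOps)
      (fun Λ hΛ => hΛ.1) fun Λ hΛ σ hσ => hΛ.2 σ (EntDist.pptPlusStates_subset_rainsSet
        (EntDist.sepStates_subset_pptPlusStates hσ))
  · exact EntDist.fidelityOfDistillation_isotropic hd hm hf0 hf1
      (EntDist.sepOps_subset_pptOps.trans EntDist.pptOps_subset_pptPlusPreservingOps)
      (fun Λ hΛ => hΛ.1) fun Λ hΛ σ hσ => EntDist.pptPlusStates_subset_rainsSet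
        (hΛ.2 σ (EntDist.sepStates_subset_pptPlusStates hσ))
  · exact EntDist.fidelityOfDistillation_isotropic hd hm hf0 hf1
      EntDist.sepOps_subset_sepPreservingOps
      (fun Λ hΛ => hΛ.1) fun Λ hΛ σ hσ => EntDist.pptPlusStates_subset_rainsSet
        (EntDist.sepStates_subset_pptPlusStates (hΛ.2 σ hσ))
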